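/- Let $\mathbf\Phi$ be an irreducible and positive recurrent discrete-time Markov chain of $GI/G/1$-type: its state space is $E=\bigcup_{i\ge 0}\ell(i)$ with levels $\ell(i)=\{(i,k):1\le k\le d\}$, $d<\infty$, and its transition matrix is the stochastic matrix $$P=\begin{bmatrix} B_0&B_1&B_2&\cdots\\ B_{-1}&A_0&A_1&\cdots\\ B_{-2}&A_{-1}&A_0&\cdots\\ \vdots&\vdots&\vdots&\ddots\end{bmatrix},$$ where $A_i,B_i$ $(i\in\mathbb Z)$ are non-negative $d\times d$ matrices. Let $\boldsymbol\pi$ be the invariant probability vector of $P$, $\boldsymbol\pi_j$ its restriction to $\ell(j)$, and $\boldsymbol e$ the column vector of ones. Write $\widehat M=\sum_{k\ge0}M^k$. Let $A=\ell(0)$ and $B=E\setminus A$, and partition $P$ into $P_{AA},P_{AB},P_{BA},P_{BB}$ accordingly. Let $P^{(A)}$ (also written $P^{(0)}$) be the transition matrix of the chain censored on $A$, i.e. of $\Phi_{\theta_k}$, $k\ge 0$, where $\theta_0<\theta_1<\cdots$ are the successive visit times to $A$. Let $W^{\#}$ denote the group inverse of a finite square matrix $W$, i.e. the unique matrix with $WW^\#W=W$,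 $W^\#WW^\#=W^\#$, $W^\#W=WW^\#$. Let $\widetilde X$ be the matrix whose rows in $A$ and in $B$ are $$\widetilde X_A=(I-P^{(A)})^{\#}\Big(\big[I,\,P_{AB}\widehat P_{BB}\big]-\big(\boldsymbol e+P_{AB}\widehat P_{BB}\boldsymbol e\big)\boldsymbol\pi^T\Big),\qquad \widetilde X_B=\widehat P_{BB}P_{BA}\widetilde X_A+\big[O,\widehat P_{BB}\big]-\widehat P_{BB}\boldsymbol e\boldsymbol\pi^T ,$$ and let $\widetilde X_{ij}$ be its $d\times d$ block with rows in $\ell(i)$ and columns in $\ell(j)$. Let $H=(A_{j-i})_{i,j\ge1}$ be the matrix obtained from $P$ by deleting the first block row and block column, and $\widehat H_{ij}$, $i,j\ge1$, the blocks of $\widehat H$. Then the group inverse $(I-P^{(0)})^\#$ exists, all the series above and below converge, and $$\widetilde X_{ij}=\begin{cases} (I-P^{(0)})^{\#}\Big(I-\Big(I+\sum_{m=1}^\infty\sum_{n=1}^\infty B_n\widehat H_{nm}\Big)\boldsymbol e\boldsymbol\pi_0^T\Big), & i=0,\ j=0,\\ \widetilde X_{00}\sum_{n=1}^\infty B_n\widehat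 H_{nj}, & i=0,\ j\ge1,\\ \Big(\sum_{m=1}^\infty\widehat H_{im}B_{-m}\Big)\widetilde X_{00}-\Big(\sum_{m=1}^\infty\widehat H_{im}\Big)\boldsymbol e\boldsymbol\pi_0^T, & i\ge1,\ j=0,\\ \Big(\sum_{m=1}^\infty\widehat H_{im}B_{-m}\Big)\widetilde X_{0j}+\widehat H_{ij}-\Big(\sum_{m=1}^\infty\widehat H_{im}\Big)\boldsymbol e\boldsymbol\pi_j^T, & i\ge1,\ j\ge1. \end{cases}$$ -/

import Mathlib

open MeasureTheory
open scoped ENNReal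

noncomputable section

namespace GIG1

/-! ### Matrices over countable index sets -/

/-- The product of two possibly infinite matrices, `(M N)(i, k) = ∑ⱼ M(i, j) N(j, k)`. -/
def infMul {α β γ : Type*} (M : Matrix α β ℝ) (N : Matrix β γ ℝ) : Matrix α γ ℝ :=
  fun i k => ∑' j, M i j * N j k

/-- The powers `M⁰ = I`, `Mᵏ⁺¹ = Mᵏ M` of a possibly infinite square matrix. -/
def infPow {α : Type*} [DecidableEq α] (M : Matrix α α ℝ) : ℕ → Matrix α α ℝ
  | 0 => 1
  | k + 1 => infMul (infPow M k) M

/-- The fundamental matrix `M̂ = ∑ₖ Mᵏ`. -/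
def hat {α : Type*} [DecidableEq α] (M : Matrix α α ℝ) : Matrix α α ℝ :=
  fun i j => ∑' k, infPow M k i j

/-- The vector `M e` of row sums. -/
def rowSum {α β : Type*} (M : Matrix α β ℝ) : α → ℝ := fun i => ∑' j, M i j

/-- The infinite sums in the definition of `M̂ = ∑ₖ Mᵏ` converge. -/
structure HatConverges {α : Type*} [DecidableEq α] (M : Matrix α α ℝ) : Prop where
  powers : ∀ k i j, Summable fun l => infPow M k i l * M l j
  series : ∀ i j, Summable fun k => infPow M k i j

/-- `Y` is the group inverse of the finite square matrix `W`. -/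
structure IsGroupInverse {n : Type*} [Fintype n] (W Y : Matrix n n ℝ) : Prop where
  mul_mul : W * Y * W = W
  mul_mul' : Y * W * Y = Y
  comm : Y * W = W * Y

theorem IsGroupInverse.unique {n : Type*} [Fintype n] {W Y Z : Matrix n n ℝ}
    (hY : IsGroupInverse W Y) (hZ : IsGroupInverse W Z) : Y = Z := by
  have key : Y * W = W * Z := by
    calc Y * W = W * Y := hY.comm
      _ = W * Z * W * Y := by rw [hZ.mul_mul]
      _ = Z * W * (W * Y) := by rw [← hZ.comm, Matrix.mul_assoc]
      _ = Z * (W * (Y * W)) := by rw [hY.comm, Matrix.mul_assoc]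
      _ = Z * (W * Y * W) := by rw [Matrix.mul_assoc W Y W]
      _ = W * Z := by rw [hY.mul_mul, hZ.comm]
  calc Y = Y * W * Y := hY.mul_mul'.symm
    _ = Z * W * Y := by rw [key, ← hZ.comm]
    _ = Z * (W * Z) := by rw [Matrix.mul_assoc, ← hY.comm, key]
    _ = Z := by rw [← Matrix.mul_assoc, hZ.mul_mul']

open Classical in
/-- The group inverse `W#` (the zero matrix if `W` has none). -/
def groupInverse {n : Type*} [Fintype n] (W : Matrix n n ℝ) : Matrix n n ℝ :=
  if h : ∃ Y, IsGroupInverse W Y then h.choose else 0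

/-! ### Markov chains on a countable state space -/

/-- `P` is a transition probability matrix. -/
structure IsStochastic {E : Type*} (P : Matrix E E ℝ) : Prop where
  nonneg : ∀ i j, 0 ≤ P i j
  hasSum_one : ∀ i, HasSum (P i) 1

/-- `π` is an invariant probability vector of `P`: `π ≥ 0`, `πᵀ e = 1` and `πᵀ P = πᵀ`. -/
structure IsInvariantProbability {E : Type*} (P : Matrix E E ℝ) (π : E → ℝ) : Prop where
  nonneg : ∀ i, 0 ≤ π i
  hasSum_one : HasSum π 1
  invariant : ∀ j, HasSum (fun i => π i * P i j) (π j)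

/-- Under each probability measure `ℙ i`, the process `Φ` is a Markov chain with transition
matrix `P` and initial state `i`. -/
structure IsMarkovChain {E Ω : Type*} [DecidableEq E] [MeasurableSpace E] [MeasurableSpace Ω]
    (P : Matrix E E ℝ) (ℙ : E → Measure Ω) (Φ : ℕ → Ω → E) : Prop where
  isProbabilityMeasure : ∀ i, IsProbabilityMeasure (ℙ i)
  measurable : ∀ n, Measurable (Φ n)
  path_prob : ∀ (i : E) (n : ℕ) (x : ℕ → E),
    ℙ i {ω | ∀ k ≤ n, Φ k ω = x k} =
      if x 0 = i then ∏ k ∈ Finset.range n, ENNReal.ofReal (P (x k) (x (k + 1))) else 0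

/-- The first return time `τ_A = inf {k ≥ 1 : x k ∈ A}` of a path `x`. -/
def returnTime {E : Type*} (A : Set E) (x : ℕ → E) : ℕ∞ :=
  ⨅ (k : ℕ) (_ : 1 ≤ k) (_ : x k ∈ A), (k : ℕ∞)

/-- Positive recurrence: `𝔼ᵢ[τᵢ] < ∞` for every state `i`. -/
def IsPositiveRecurrent {E Ω : Type*} [MeasurableSpace Ω]
    (ℙ : E → Measure Ω) (Φ : ℕ → Ω → E) : Prop :=
  ∀ i, ∫⁻ ω, ((returnTime {i} fun k => Φ k ω : ℕ∞) : ℝ≥0∞) ∂(ℙ i) < ∞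

/-- The successive visit times to `A`: `θ₀ = inf {m ≥ 0 : x m ∈ A}` and
`θₖ₊₁ = inf {m ≥ θₖ + 1 : x m ∈ A}`. -/
def visitTime {E : Type*} (A : Set E) (x : ℕ → E) : ℕ → ℕ∞
  | 0 => ⨅ (m : ℕ) (_ : x m ∈ A), (m : ℕ∞)
  | k + 1 => ⨅ (m : ℕ) (_ : visitTime A x k + 1 ≤ (m : ℕ∞)) (_ : x m ∈ A), (m : ℕ∞)

/-- The transition matrix `P^(A)` of the censored chain `Φ^(A)ₖ = Φ_{θₖ}`, that is,
`P^(A)(i, j) = ℙᵢ(Φ^(A)₁ = j)` for `i, j ∈ A` (a chain started in `A` has `Φ^(A)₀ = Φ₀`). -/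
def censoredMatrix {E Ω : Type*} [MeasurableSpace Ω]
    (ℙ : E → Measure Ω) (Φ : ℕ → Ω → E) (A : Finset E) : Matrix A A ℝ :=
  fun i j => (ℙ i {ω | ∃ m : ℕ,
    visitTime (A : Set E) (fun k => Φ k ω) 1 = (m : ℕ∞) ∧ Φ m ω = j}).toReal

/-! ### The matrix solution `X̃` of Poisson's equation for a finite set `A`, with `B = Aᶜ` -/

section Solution

variable {E : Type*} [DecidableEq E]

/-- `P_AB`. -/
def PAB (P : Matrix E E ℝ) (A : Finset E) : Matrix A {x // x ∉ A} ℝ :=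
  P.submatrix Subtype.val Subtype.val

/-- `P_BA`. -/
def PBA (P : Matrix E E ℝ) (A : Finset E) : Matrix {x // x ∉ A} A ℝ :=
  P.submatrix Subtype.val Subtype.val

/-- `P_BB`. -/
def PBB (P : Matrix E E ℝ) (A : Finset E) : Matrix {x // x ∉ A} {x // x ∉ A} ℝ :=
  P.submatrix Subtype.val Subtype.val

/-- The infinite sums in the definition of `X̃` converge. -/
structure SeriesConverge (P : Matrix E E ℝ) (A : Finset E) : Prop where
  hat : HatConverges (PBB P A)
  mul_hat : ∀ i j, Summable fun l => PAB P A i l * GIG1.hat (PBB P A) l j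
  rowSum_mul_hat : ∀ i, Summable (infMul (PAB P A) (GIG1.hat (PBB P A)) i)
  hat_mul : ∀ i j, Summable fun l => GIG1.hat (PBB P A) i l * PBA P A l j
  rowSum_hat : ∀ i, Summable (GIG1.hat (PBB P A) i)

/-- The rows of `X̃` in `A`:
`X̃_A = (I - P^(A))# ([I, P_AB P̂_BB] - (e + P_AB P̂_BB e) πᵀ)`,
where `PA` is the censored transition matrix `P^(A)`. -/
def solutionA (P : Matrix E E ℝ) (π : E → ℝ) (A : Finset E) (PA : Matrix A A ℝ) :
    Matrix A E ℝ :=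
  groupInverse (1 - PA) *
    ((Matrix.of fun i j => if h : j ∈ A then (1 : Matrix A A ℝ) i ⟨j, h⟩
        else infMul (PAB P A) (hat (PBB P A)) i ⟨j, h⟩) -
      Matrix.vecMulVec (1 + rowSum (infMul (PAB P A) (hat (PBB P A)))) π)

/-- The rows of `X̃` in `B`:
`X̃_B = P̂_BB P_BA X̃_A + [O, P̂_BB] - P̂_BB e πᵀ`. -/
def solutionB (P : Matrix E E ℝ) (π : E → ℝ) (A : Finset E) (PA : Matrix A A ℝ) :
    Matrix {x // x ∉ A} E ℝ :=
  infMul (hat (PBB P A)) (PBA P A) * solutionA P π A PA +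
    (Matrix.of fun i j => if h : j ∈ A then 0 else hat (PBB P A) i ⟨j, h⟩) -
      Matrix.vecMulVec (rowSum (hat (PBB P A))) π

/-- The matrix `X̃`, with rows `X̃_A` and `X̃_B`. -/
def solution (P : Matrix E E ℝ) (π : E → ℝ) (A : Finset E) (PA : Matrix A A ℝ) :
    Matrix E E ℝ :=
  fun i j => if h : i ∈ A then solutionA P π A PA ⟨i, h⟩ j else solutionB P π A PA ⟨i, h⟩ j

end Solution

/-! ### Chains of GI/G/1-type; the state `(i, k)` is phase `k` of level `i` -/

/-- The transition matrix of GI/G/1-type with blocks `Aᵢ`, `Bᵢ`, `i ∈ ℤ`, of size `d`. -/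
def gig1Matrix {d : ℕ} (A B : ℤ → Matrix (Fin d) (Fin d) ℝ) :
    Matrix (ℕ × Fin d) (ℕ × Fin d) ℝ :=
  fun x y =>
    if x.1 = 0 then B (y.1 : ℤ) x.2 y.2
    else if y.1 = 0 then B (-(x.1 : ℤ)) x.2 y.2
    else A ((y.1 : ℤ) - (x.1 : ℤ)) x.2 y.2

/-- The repeating part `H`, with blocks `H_{ij} = A_{j-i}`, `i, j ≥ 1`. -/
def repeatingPart {d : ℕ} (A : ℤ → Matrix (Fin d) (Fin d) ℝ) :
    Matrix (ℕ+ × Fin d) (ℕ+ × Fin d) ℝ :=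
  fun x y => A ((y.1 : ℤ) - (x.1 : ℤ)) x.2 y.2

/-- The level `ℓ(0)`. -/
def level0 (d : ℕ) : Finset (ℕ × Fin d) := {0} ×ˢ Finset.univ

/-- The states of level `0`, numbered by their phases. -/
def level0State {d : ℕ} (k : Fin d) : level0 d := ⟨(0, k), by simp [level0]⟩

/-- The block `M_{ij}` of a block-structured matrix. -/
def block {ι : Type*} {d : ℕ} (M : Matrix (ι × Fin d) (ι × Fin d) ℝ) (i j : ι) :
    Matrix (Fin d) (Fin d) ℝ :=
  Matrix.of fun k l => M (i, k) (j, l)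

/-- The block `e πⱼᵀ`. -/
def ePi {d : ℕ} (π : ℕ × Fin d → ℝ) (j : ℕ) : Matrix (Fin d) (Fin d) ℝ :=
  Matrix.vecMulVec 1 fun l => π (j, l)

end GIG1

end

/-! With `A` equal to level 0, the blocks of `P_AB P̂_BB`, `P̂_BB P_BA` and `P̂_BB` are `∑ B_n
Ĥ_nj`, `∑ Ĥ_im B_{-m}` and `Ĥ_ij`, so three of the four formulas are the definition of `X̃` read
block by block. The remaining one, for `X̃_0j`, rests on `π_B = π_A P_AB P̂_BB`
(`invariant_compl_eq`), which turns `e π_0ᵀ ∑ B_n Ĥ_nj` into `e π_jᵀ` and lets `X̃_00` factor out on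
the left.

Convergence comes from the invariant vector. Iterating `π_B = π_A P_AB + π_B P_BB` gives `π_A P_AB
P̂_BB ≤ π_B`; as `π > 0`, the row sums of `P_AB P̂_BB` are finite, and irreducibility carries
finiteness on to the rows of `P̂_BB` (`tsum_ehat_ne_top`). The remainder `π_B P_BB^n` then vanishes
by dominated convergence, so the inequality is an equality. These arguments run in `[0, ∞]`, where
sums may be interchanged before finiteness is known, and are carried to `ℝ` by `toReal`.

The group inverse needs only that the finite censored matrix is substochastic: its powers are then
bounded, which forces `ker (I - M)² = ker (I - M)` (`exists_isGroupInverse_one_sub`). -/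

noncomputable section

namespace GIG1

/-! ### Extended-nonnegative matrices -/

/-- The product of two possibly infinite matrices with entries in `[0, ∞]`. -/
def emul {α β γ : Type*} (M : α → β → ℝ≥0∞) (N : β → γ → ℝ≥0∞) : α → γ → ℝ≥0∞ :=
  fun i k => ∑' j, M i j * N j k

/-- The powers of a possibly infinite square matrix with entries in `[0, ∞]`. -/
def epow {α : Type*} [DecidableEq α] (M : α → α → ℝ≥0∞) : ℕ → α → α → ℝ≥0∞
  | 0 => fun i j => if i = j then 1 else 0
  | k + 1 => emul (epow M k) M

/-- The fundamental matrix of a matrix with entries in `[0, ∞]`. -/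
def ehat {α : Type*} [DecidableEq α] (M : α → α → ℝ≥0∞) : α → α → ℝ≥0∞ :=
  fun i j => ∑' k, epow M k i j

/-- A real matrix viewed as a matrix with entries in `[0, ∞]`. -/
def toE {α β : Type*} (M : Matrix α β ℝ) : α → β → ℝ≥0∞ := fun i j => ENNReal.ofReal (M i j)

theorem emul_assoc {α β γ δ : Type*} (L : α → β → ℝ≥0∞) (M : β → γ → ℝ≥0∞)
    (N : γ → δ → ℝ≥0∞) : emul (emul L M) N = emul L (emul M N) := by
  funext i l
  simp only [emul, ← ENNReal.tsum_mul_right, ← ENNReal.tsum_mul_left]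
  rw [ENNReal.tsum_comm]
  simp only [mul_assoc]

theorem tsum_emul_le {α β γ : Type*} {L : α → γ → ℝ≥0∞} {M : γ → β → ℝ≥0∞}
    (hM : ∀ i, ∑' j, M i j ≤ 1) (i : α) : ∑' j, emul L M i j ≤ ∑' j, L i j := by
  simp only [emul]
  rw [ENNReal.tsum_comm]
  simp only [ENNReal.tsum_mul_left]
  exact ENNReal.tsum_le_tsum fun j => mul_le_of_le_one_right' (hM j)

section Powers

variable {α β : Type*} [DecidableEq β]

theorem emul_epow_zero (Q : α → β → ℝ≥0∞) (M : β → β → ℝ≥0∞) : emul Q (epow M 0) = Q := by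
  funext i j
  simp only [emul, epow]
  rw [tsum_eq_single j]
  · simp
  · intro b hb
    simp [hb]

theorem epow_zero_emul (M : β → β → ℝ≥0∞) (Q : β → α → ℝ≥0∞) : emul (epow M 0) Q = Q := by
  funext i j
  simp only [emul, epow]
  rw [tsum_eq_single i]
  · simp
  · intro b hb
    simp [hb.symm]

theorem epow_succ' (M : β → β → ℝ≥0∞) (k : ℕ) : epow M (k + 1) = emul M (epow M k) := by
  induction k with
  | zero => rw [emul_epow_zero, epow, epow_zero_emul]
  | succ k ih => rw [epow, ih, emul_assoc, ← epow, ih]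

theorem emul_ehat (Q : α → β → ℝ≥0∞) (M : β → β → ℝ≥0∞) (i : α) (j : β) :
    emul Q (ehat M) i j = ∑' k, emul Q (epow M k) i j := by
  simp only [emul, ehat, ← ENNReal.tsum_mul_left]
  rw [ENNReal.tsum_comm]

theorem emul_ehat_le (M : β → β → ℝ≥0∞) (i j : β) : emul M (ehat M) i j ≤ ehat M i j := by
  rw [emul_ehat]
  simp only [← epow_succ', ehat]
  exact ENNReal.tsum_comp_le_tsum_of_injective (add_left_injective 1) fun k => epow M k i j

theorem tsum_epow_le {M : β → β → ℝ≥0∞} (hM : ∀ i, ∑' j, M i j ≤ 1) (k : ℕ) (i : β) :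
    ∑' j, epow M k i j ≤ 1 := by
  induction k with
  | zero => simp [epow]
  | succ k ih => exact (tsum_emul_le hM i).trans ih

end Powers

section ToReal

variable {α β γ : Type*}

theorem infMul_eq_toReal {M : Matrix α β ℝ} {N : Matrix β γ ℝ} {M' : α → β → ℝ≥0∞}
    {N' : β → γ → ℝ≥0∞} (hM : ∀ i j, M i j = (M' i j).toReal)
    (hN : ∀ i j, N i j = (N' i j).toReal) {i : α} {k : γ} (h : emul M' N' i k ≠ ∞) :
    infMul M N i k = (emul M' N' i k).toReal := by
  simp only [infMul, emul, hM, hN, ← ENNReal.toReal_mul]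
  exact (ENNReal.tsum_toReal_eq (ENNReal.ne_top_of_tsum_ne_top h)).symm

theorem summable_mul_of_emul_ne_top {M : Matrix α β ℝ} {N : Matrix β γ ℝ} {M' : α → β → ℝ≥0∞}
    {N' : β → γ → ℝ≥0∞} (hM : ∀ i j, M i j = (M' i j).toReal)
    (hN : ∀ i j, N i j = (N' i j).toReal) {i : α} {k : γ} (h : emul M' N' i k ≠ ∞) :
    Summable fun j => M i j * N j k := by
  simp only [hM, hN, ← ENNReal.toReal_mul]
  exact ENNReal.summable_toReal h

theorem toReal_toE {M : Matrix α β ℝ} (hM : ∀ i j, 0 ≤ M i j) (i : α) (j : β) :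
    M i j = (toE M i j).toReal := (ENNReal.toReal_ofReal (hM i j)).symm

variable [DecidableEq β] {M : Matrix β β ℝ}

theorem epow_ne_top {M : β → β → ℝ≥0∞} (hM : ∀ i, ∑' j, M i j ≤ 1) (k : ℕ) (i j : β) :
    epow M k i j ≠ ∞ :=
  ENNReal.ne_top_of_tsum_ne_top ((tsum_epow_le hM k i).trans_lt ENNReal.one_lt_top).ne j

theorem infPow_eq_toReal (hM : ∀ i j, 0 ≤ M i j) (hs : ∀ i, ∑' j, toE M i j ≤ 1) (k : ℕ)
    (i j : β) : infPow M k i j = (epow (toE M) k i j).toReal := by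
  induction k generalizing i j with
  | zero =>
    by_cases h : i = j <;> simp [infPow, epow, Matrix.one_apply, h]
  | succ k ih => exact infMul_eq_toReal ih (toReal_toE hM) (epow_ne_top hs (k + 1) i j)

theorem hat_eq_toReal (hM : ∀ i j, 0 ≤ M i j) (hs : ∀ i, ∑' j, toE M i j ≤ 1) (i j : β) :
    hat M i j = (ehat (toE M) i j).toReal := by
  simp only [hat, ehat, infPow_eq_toReal hM hs]
  exact (ENNReal.tsum_toReal_eq fun k => epow_ne_top hs k i j).symm

theorem hatConverges_of_ehat_ne_top (hM : ∀ i j, 0 ≤ M i j) (hs : ∀ i, ∑' j, toE M i j ≤ 1)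
    (h : ∀ i j, ehat (toE M) i j ≠ ∞) : HatConverges M where
  powers k i j := summable_mul_of_emul_ne_top (infPow_eq_toReal hM hs k) (toReal_toE hM)
    (epow_ne_top hs (k + 1) i j)
  series i j := by
    simp only [infPow_eq_toReal hM hs]
    exact ENNReal.summable_toReal (h i j)

end ToReal

/-! ### Invariant vectors and the taboo expansion -/

section Taboo

variable {α β : Type*} [DecidableEq β] {a : α → ℝ≥0∞} {b : β → ℝ≥0∞}
  {Q : α → β → ℝ≥0∞} {M : β → β → ℝ≥0∞}

/-- Iterating `b = a Q + b M`. -/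
theorem eq_sum_range_add (h : ∀ j, b j = ∑' i, a i * Q i j + ∑' i, b i * M i j) (n : ℕ) (j : β) :
    b j = ∑ k ∈ Finset.range n, ∑' i, a i * emul Q (epow M k) i j + ∑' i, b i * epow M n i j := by
  -- Vectors become one-row matrices, so that `emul_assoc` applies to them.
  let a' : Unit → α → ℝ≥0∞ := fun _ => a
  let b' : Unit → β → ℝ≥0∞ := fun _ => b
  have hb : b' = fun u j => emul a' Q u j + emul b' M u j := by
    funext u j
    exact h j
  suffices H : ∀ j, b' () j =
      ∑ k ∈ Finset.range n, emul a' (emul Q (epow M k)) () j + emul b' (epow M n) () j from H j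
  clear j
  induction n with
  | zero => simp [emul_epow_zero]
  | succ n ih =>
    intro j
    -- Multiplying the expansion of `b` by `M` raises every power by one; the missing term `k = 0`
    -- is `a Q`.
    have e : emul b' M () j = ∑ k ∈ Finset.range n, emul a' (emul Q (epow M (k + 1))) () j
        + emul b' (epow M (n + 1)) () j := by
      have : emul b' M () j = ∑' i, (∑ k ∈ Finset.range n, emul a' (emul Q (epow M k)) () i
          + emul b' (epow M n) () i) * M i j := by
        simp only [← ih]
        rfl
      rw [this]
      simp only [add_mul, ENNReal.tsum_add, Finset.sum_mul]
      rw [Summable.tsum_finsetSum fun _ _ => ENNReal.summable]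
      simp only [epow, ← emul_assoc]
      rfl
    rw [Finset.sum_range_succ', emul_epow_zero, add_right_comm, ← e, add_comm]
    exact congrFun (congrFun hb ()) j

/-- The remainder `b Mⁿ` is nonnegative and can be dropped. No finiteness is assumed, so the bound
can itself serve to prove finiteness. -/
theorem tsum_mul_emul_ehat_le (h : ∀ j, b j = ∑' i, a i * Q i j + ∑' i, b i * M i j) (j : β) :
    ∑' i, a i * emul Q (ehat M) i j ≤ b j := by
  simp only [emul_ehat, ← ENNReal.tsum_mul_left]
  rw [ENNReal.tsum_comm, ENNReal.tsum_eq_iSup_nat]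
  refine iSup_le fun n => ?_
  rw [eq_sum_range_add h n j]
  exact le_self_add

/-- Convergence of the series for `M̂` makes `Mⁿ` tend to zero entrywise, and the summable `b`
dominates because entries of `Mⁿ` are at most 1. -/
theorem tendsto_tsum_mul_epow (hb : ∑' i, b i ≠ ∞) (hM : ∀ i, ∑' j, M i j ≤ 1)
    (hf : ∀ i j, ehat M i j ≠ ∞) (j : β) :
    Filter.Tendsto (fun n => ∑' i, b i * epow M n i j) Filter.atTop (nhds 0) := by
  let : MeasurableSpace β := ⊤
  have key := tendsto_lintegral_of_dominated_convergence (μ := Measure.count)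
    (F := fun n i => b i * epow M n i j) (f := fun _ => 0) b (fun _ _ _ => trivial)
    (fun n => .of_forall fun i => mul_le_of_le_one_right'
      ((ENNReal.le_tsum j).trans (tsum_epow_le hM n i)))
    (by rwa [lintegral_count])
    (.of_forall fun i => by
      have := ENNReal.Tendsto.const_mul (a := b i)
        (ENNReal.tendsto_atTop_zero_of_tsum_ne_top (hf i j))
        (Or.inr (ENNReal.ne_top_of_tsum_ne_top hb i))
      simpa using this)
  simpa [lintegral_count] using key

theorem eq_tsum_mul_emul_ehat (h : ∀ j, b j = ∑' i, a i * Q i j + ∑' i, b i * M i j)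
    (hb : ∑' i, b i ≠ ∞) (hM : ∀ i, ∑' j, M i j ≤ 1) (hf : ∀ i j, ehat M i j ≠ ∞) (j : β) :
    b j = ∑' i, a i * emul Q (ehat M) i j := by
  simp only [emul_ehat, ← ENNReal.tsum_mul_left]
  rw [ENNReal.tsum_comm]
  have h1 := ((ENNReal.summable (f := fun k => ∑' i, a i * emul Q (epow M k) i j)).hasSum
    |>.tendsto_sum_nat).add (tendsto_tsum_mul_epow hb hM hf j)
  simp only [← eq_sum_range_add h, add_zero] at h1
  exact tendsto_nhds_unique tendsto_const_nhds h1

end Taboo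

/-! ### Irreducible chains with an invariant probability vector -/

/-- A set of states of an irreducible chain that is nonempty and closed contains all states. -/
theorem forall_of_isIrreducible_of_closed {E : Type*} {P : Matrix E E ℝ} (hP : P.IsIrreducible)
    {S : E → Prop} {x : E} (hx : S x) (hS : ∀ x y, S x → 0 < P x y → S y) (y : E) : S y := by
  let : Quiver E := P.toQuiver
  obtain ⟨p, -⟩ := hP.connected x y
  induction p with
  | nil => exact hx
  | cons _ e ih => exact hS _ _ ih e.down

/-- The support of `π` is nonempty since the total mass is 1, and closed under transitions since `π
y ≥ π x * P x y`. -/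
theorem IsInvariantProbability.pos {E : Type*} {P : Matrix E E ℝ} (hP : P.IsIrreducible)
    {π : E → ℝ} (hπ : IsInvariantProbability P π) (x : E) : 0 < π x := by
  obtain ⟨y, hy⟩ : ∃ y, 0 < π y := by
    by_contra! h
    have h0 : π = 0 := funext fun y => le_antisymm (h y) (hπ.nonneg y)
    have := hπ.hasSum_one
    rw [h0] at this
    exact zero_ne_one (hasSum_zero.unique this)
  refine forall_of_isIrreducible_of_closed hP (S := fun x => 0 < π x) hy (fun x y hx hxy => ?_) x
  exact (mul_pos hx hxy).trans_le (le_hasSum (hπ.invariant y) x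
    fun i _ => mul_nonneg (hπ.nonneg i) (hP.nonneg i y))

section Blocks

variable {E : Type*} {P : Matrix E E ℝ} {π : E → ℝ} (A : Finset E)

theorem tsum_eq_tsum_mem_add {E : Type*} (A : Finset E) (f : E → ℝ≥0∞) :
    ∑' x, f x = ∑' x : A, f x + ∑' x : {x // x ∉ A}, f x :=
  (ENNReal.summable.tsum_add_tsum_compl (s := (A : Set E)) ENNReal.summable).symm

theorem tsum_toE_eq_one (hP : IsStochastic P) (i : E) : ∑' j, toE P i j = 1 := by
  simp only [toE]
  rw [← ENNReal.ofReal_tsum_of_nonneg (hP.nonneg i) (hP.hasSum_one i).summable,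
    (hP.hasSum_one i).tsum_eq, ENNReal.ofReal_one]

theorem tsum_toE_PBB_le [DecidableEq E] (hP : IsStochastic P) (i : {x // x ∉ A}) :
    ∑' j, toE (PBB P A) i j ≤ 1 :=
  (ENNReal.tsum_comp_le_tsum_of_injective Subtype.val_injective (toE P i)).trans
    (tsum_toE_eq_one hP i).le

theorem IsInvariantProbability.tsum_ofReal (hπ : IsInvariantProbability P π) :
    ∑' x, ENNReal.ofReal (π x) = 1 := by
  rw [← ENNReal.ofReal_tsum_of_nonneg hπ.nonneg hπ.hasSum_one.summable,
    hπ.hasSum_one.tsum_eq, ENNReal.ofReal_one]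

theorem IsInvariantProbability.tsum_ofReal_compl_le (hπ : IsInvariantProbability P π) :
    ∑' x : {x // x ∉ A}, ENNReal.ofReal (π x) ≤ 1 :=
  (ENNReal.tsum_comp_le_tsum_of_injective Subtype.val_injective
    fun x => ENNReal.ofReal (π x)).trans hπ.tsum_ofReal.le

theorem IsInvariantProbability.eq_block (hP : IsStochastic P) (hπ : IsInvariantProbability P π)
    (j : {x // x ∉ A}) :
    ENNReal.ofReal (π j) = ∑' i : A, ENNReal.ofReal (π i) * toE (PAB P A) i j +
      ∑' i : {x // x ∉ A}, ENNReal.ofReal (π i) * toE (PBB P A) i j := by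
  rw [← (hπ.invariant j).tsum_eq, ENNReal.ofReal_tsum_of_nonneg
    (fun i => mul_nonneg (hπ.nonneg i) (hP.nonneg i j)) (hπ.invariant j).summable,
    tsum_eq_tsum_mem_add A]
  simp only [ENNReal.ofReal_mul (hπ.nonneg _)]
  rfl

variable [DecidableEq E] (hP : IsStochastic P) (hirr : P.IsIrreducible) (hπ : IsInvariantProbability P π)

include hP in
theorem hat_PBB_eq_toReal (i j : {x // x ∉ A}) :
    hat (PBB P A) i j = (ehat (toE (PBB P A)) i j).toReal :=
  hat_eq_toReal (fun _ _ => hP.nonneg _ _) (tsum_toE_PBB_le A hP) i j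

include hP hirr hπ

/-- Weighted by `π i > 0`, this row sum is at most the mass of `π` outside `A`. -/
theorem tsum_emul_ehat_ne_top (i : A) :
    ∑' j, emul (toE (PAB P A)) (ehat (toE (PBB P A))) i j ≠ ∞ := by
  have h1 : ENNReal.ofReal (π i) * ∑' j, emul (toE (PAB P A)) (ehat (toE (PBB P A))) i j ≤ 1 := by
    rw [← ENNReal.tsum_mul_left]
    refine le_trans (ENNReal.tsum_le_tsum fun j => ?_) (hπ.tsum_ofReal_compl_le A)
    refine le_trans ?_ (tsum_mul_emul_ehat_le (hπ.eq_block A hP) j)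
    exact ENNReal.le_tsum (f := fun i : A => ENNReal.ofReal (π i) *
      emul (toE (PAB P A)) (ehat (toE (PBB P A))) i j) i
  intro h
  rw [h, ENNReal.mul_top (by simpa using hπ.pos hirr i)] at h1
  simp at h1

theorem tsum_ehat_ne_top (hA : A.Nonempty) (i : {x // x ∉ A}) :
    ∑' j, ehat (toE (PBB P A)) i j ≠ ∞ := by
  obtain ⟨a, ha⟩ := hA
  -- The propagated property is vacuous on `A`, so it holds at `a`. An infinite row sum at `y ∉ A`
  -- with `P x y > 0` would force one at `x`: in `P_AB P̂_BB` if `x ∈ A`, in `P_BB P̂_BB ≤ P̂_BB`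
  -- otherwise.
  refine forall_of_isIrreducible_of_closed hirr (x := a)
    (S := fun x => ∀ h : x ∉ A, ∑' j, ehat (toE (PBB P A)) ⟨x, h⟩ j ≠ ∞)
    (fun h => absurd ha h) (fun x y hx hxy hy htop => ?_) i i.2
  have hpos : ENNReal.ofReal (P x y) ≠ 0 := by simpa using hxy
  by_cases hxA : x ∈ A
  · refine tsum_emul_ehat_ne_top A hP hirr hπ ⟨x, hxA⟩ (top_le_iff.mp ?_)
    calc ∞ = toE (PAB P A) ⟨x, hxA⟩ ⟨y, hy⟩ * ∑' j, ehat (toE (PBB P A)) ⟨y, hy⟩ j := by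
          rw [htop]
          exact (ENNReal.mul_top hpos).symm
      _ ≤ _ := by
          rw [← ENNReal.tsum_mul_left]
          exact ENNReal.tsum_le_tsum fun j => ENNReal.le_tsum
            (f := fun l => toE (PAB P A) ⟨x, hxA⟩ l * ehat (toE (PBB P A)) l j) ⟨y, hy⟩
  · refine hx hxA (top_le_iff.mp ?_)
    calc ∞ = toE (PBB P A) ⟨x, hxA⟩ ⟨y, hy⟩ * ∑' j, ehat (toE (PBB P A)) ⟨y, hy⟩ j := by
          rw [htop]
          exact (ENNReal.mul_top hpos).symm
      _ ≤ _ := by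
          rw [← ENNReal.tsum_mul_left]
          exact ENNReal.tsum_le_tsum fun j => (ENNReal.le_tsum
            (f := fun l => toE (PBB P A) ⟨x, hxA⟩ l * ehat (toE (PBB P A)) l j) ⟨y, hy⟩).trans
            (emul_ehat_le _ _ _)

theorem ehat_PBB_ne_top (hA : A.Nonempty) (i j : {x // x ∉ A}) :
    ehat (toE (PBB P A)) i j ≠ ∞ :=
  ENNReal.ne_top_of_tsum_ne_top (tsum_ehat_ne_top A hP hirr hπ hA i) j

theorem infMul_PAB_hat_eq_toReal (i : A) (j : {x // x ∉ A}) :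
    infMul (PAB P A) (hat (PBB P A)) i j =
      (emul (toE (PAB P A)) (ehat (toE (PBB P A))) i j).toReal :=
  infMul_eq_toReal (toReal_toE fun _ _ => hP.nonneg _ _) (hat_PBB_eq_toReal A hP)
    (ENNReal.ne_top_of_tsum_ne_top (tsum_emul_ehat_ne_top A hP hirr hπ i) j)

theorem emul_ehat_PBA_ne_top (hA : A.Nonempty) (i : {x // x ∉ A}) (j : A) :
    emul (ehat (toE (PBB P A))) (toE (PBA P A)) i j ≠ ∞ := by
  refine ne_top_of_le_ne_top (tsum_ehat_ne_top A hP hirr hπ hA i)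
    (ENNReal.tsum_le_tsum fun l => mul_le_of_le_one_right' ?_)
  have h : toE P l j ≤ ∑' k, toE P l k := ENNReal.le_tsum _
  rwa [tsum_toE_eq_one hP] at h

/-- The series in the definition of `X̃` converge for an irreducible chain with an invariant
probability vector. -/
theorem seriesConverge (hA : A.Nonempty) : SeriesConverge P A := by
  refine ⟨hatConverges_of_ehat_ne_top (fun _ _ => hP.nonneg _ _) (tsum_toE_PBB_le A hP)
    (ehat_PBB_ne_top A hP hirr hπ hA), fun i j => ?_, fun i => ?_, fun i j => ?_, fun i => ?_⟩
  · exact summable_mul_of_emul_ne_top (toReal_toE (M := PAB P A) fun _ _ => hP.nonneg _ _)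
      (hat_PBB_eq_toReal A hP)
      (ENNReal.ne_top_of_tsum_ne_top (tsum_emul_ehat_ne_top A hP hirr hπ i) j)
  · have h : infMul (PAB P A) (hat (PBB P A)) i = fun j =>
        (emul (toE (PAB P A)) (ehat (toE (PBB P A))) i j).toReal :=
      funext fun j => infMul_PAB_hat_eq_toReal A hP hirr hπ i j
    rw [h]
    exact ENNReal.summable_toReal (tsum_emul_ehat_ne_top A hP hirr hπ i)
  · exact summable_mul_of_emul_ne_top (hat_PBB_eq_toReal A hP)
      (toReal_toE (M := PBA P A) fun _ _ => hP.nonneg _ _)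
      (emul_ehat_PBA_ne_top A hP hirr hπ hA i j)
  · have h : hat (PBB P A) i = fun j => (ehat (toE (PBB P A)) i j).toReal :=
      funext fun j => hat_PBB_eq_toReal A hP i j
    rw [h]
    exact ENNReal.summable_toReal (tsum_ehat_ne_top A hP hirr hπ hA i)

/-- `π_B = π_A P_AB P̂_BB`. -/
theorem invariant_compl_eq (hA : A.Nonempty) (j : {x // x ∉ A}) :
    π j = ∑ i : A, π i * infMul (PAB P A) (hat (PBB P A)) i j := by
  have h := eq_tsum_mul_emul_ehat (hπ.eq_block A hP)
    ((hπ.tsum_ofReal_compl_le A).trans_lt ENNReal.one_lt_top).ne (tsum_toE_PBB_le A hP)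
    (ehat_PBB_ne_top A hP hirr hπ hA) j
  rw [← ENNReal.toReal_ofReal (hπ.nonneg j), h, tsum_fintype, ENNReal.toReal_sum]
  · refine Finset.sum_congr rfl fun i _ => ?_
    rw [infMul_PAB_hat_eq_toReal A hP hirr hπ, ENNReal.toReal_mul,
      ENNReal.toReal_ofReal (hπ.nonneg i)]
  · exact fun i _ => ENNReal.mul_ne_top ENNReal.ofReal_ne_top
      (ENNReal.ne_top_of_tsum_ne_top (tsum_emul_ehat_ne_top A hP hirr hπ i) j)

end Blocks

/-! ### Group inverses -/

section GroupInverse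

variable {n : Type*} [Fintype n]

/-- The hypothesis says `ker W² = ker W`. By rank-nullity `W²` and `W` have the same range, so `W =
W² X` is solvable, and `W X²` is the group inverse. -/
theorem exists_isGroupInverse [DecidableEq n] {W : Matrix n n ℝ}
    (hW : ∀ v : n → ℝ, W.mulVec (W.mulVec v) = 0 → W.mulVec v = 0) :
    ∃ Y, IsGroupInverse W Y := by
  have hker : LinearMap.ker (W.mulVecLin ∘ₗ W.mulVecLin) = LinearMap.ker W.mulVecLin := by
    ext v
    simp only [LinearMap.mem_ker, LinearMap.comp_apply, Matrix.mulVecLin_apply]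
    exact ⟨hW v, fun h => by rw [h, Matrix.mulVec_zero]⟩
  have hrange : LinearMap.range (W.mulVecLin ∘ₗ W.mulVecLin) = LinearMap.range W.mulVecLin := by
    refine Submodule.eq_of_le_of_finrank_eq (LinearMap.range_comp_le_range _ _) ?_
    have h1 := LinearMap.finrank_range_add_finrank_ker (W.mulVecLin ∘ₗ W.mulVecLin)
    have h2 := LinearMap.finrank_range_add_finrank_ker W.mulVecLin
    rw [hker] at h1
    omega
  have hcancel : ∀ Z : Matrix n n ℝ, W * (W * Z) = 0 → W * Z = 0 := by
    intro Z hZ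
    ext i j
    have := hW (Z.col j) (by
      funext i
      have := congrFun (congrFun hZ i) j
      simpa [Matrix.mul_apply, Matrix.mulVec, dotProduct] using this)
    simpa [Matrix.mul_apply, Matrix.mulVec, dotProduct] using congrFun this i
  have hcol : ∀ j, ∃ x : n → ℝ, W.mulVec (W.mulVec x) = W.col j := by
    intro j
    have : W.col j ∈ LinearMap.range W.mulVecLin := ⟨Pi.single j 1, by simp⟩
    rw [← hrange] at this
    exact this
  choose x hx using hcol
  let X : Matrix n n ℝ := Matrix.of fun i j => x j i
  have hX : W * (W * X) = W := by
    ext i j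
    have := congrFun (hx j) i
    simpa [X, Matrix.mul_apply, Matrix.mulVec, dotProduct] using this
  have hX1 : W * (X * W) = W := by
    have := hcancel (X * W - 1) (by
      rw [mul_sub, mul_sub, ← mul_assoc W X W, ← mul_assoc, hX, mul_one, sub_self])
    rwa [mul_sub, mul_one, sub_eq_zero] at this
  have hX2 : W * (X * (X * W)) = W * X := by
    have := hcancel (X * (X * W) - X) (by
      rw [mul_sub, mul_sub, ← mul_assoc W X (X * W), ← mul_assoc W (W * X), hX, hX1, sub_self])
    rwa [mul_sub, sub_eq_zero] at this
  have hWG : W * (W * (X * X)) = W * X := by rw [← mul_assoc W X X, ← mul_assoc, hX]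
  have hGW : W * (X * X) * W = W * X := by rw [mul_assoc, mul_assoc, hX2]
  -- Both products of `W` with this witness equal the idempotent `W X`.
  refine ⟨W * (X * X), ?_, ?_, ?_⟩
  · rw [hWG, mul_assoc, hX1]
  · rw [hGW, ← mul_assoc, mul_assoc W X W, hX1]
  · rw [hWG, hGW]

theorem isGroupInverse_groupInverse {W : Matrix n n ℝ} (h : ∃ Y, IsGroupInverse W Y) :
    IsGroupInverse W (groupInverse W) := by
  rw [groupInverse, dif_pos h]
  exact h.choose_spec

theorem IsGroupInverse.submatrix {m : Type*} [Fintype m] {W Y : Matrix n n ℝ}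
    (h : IsGroupInverse W Y) (e : m ≃ n) : IsGroupInverse (W.submatrix e e) (Y.submatrix e e) where
  mul_mul := by simp only [Matrix.submatrix_mul_equiv, h.mul_mul]
  mul_mul' := by simp only [Matrix.submatrix_mul_equiv, h.mul_mul']
  comm := by simp only [Matrix.submatrix_mul_equiv, h.comm]

/-- The group inverse of `I - M` exists for a substochastic matrix `M`. -/
theorem exists_isGroupInverse_one_sub [DecidableEq n] {M : Matrix n n ℝ}
    (h0 : ∀ i j, 0 ≤ M i j) (h1 : ∀ i, ∑ j, M i j ≤ 1) : ∃ Y, IsGroupInverse (1 - M) Y := by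
  refine exists_isGroupInverse fun v hv => ?_
  set y := (1 - M).mulVec v with hy
  have hMv : M.mulVec v = v - y := by simp [hy, Matrix.sub_mulVec]
  have hMy : M.mulVec y = y := by
    rw [Matrix.sub_mulVec, Matrix.one_mulVec, sub_eq_zero] at hv
    exact hv.symm
  have hnorm : ∀ u : n → ℝ, ‖M.mulVec u‖ ≤ ‖u‖ := by
    intro u
    rw [pi_norm_le_iff_of_nonneg (norm_nonneg u)]
    intro i
    calc ‖M.mulVec u i‖ ≤ ∑ j, ‖M i j * u j‖ := norm_sum_le _ _
      _ ≤ ∑ j, M i j * ‖u‖ := by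
          refine Finset.sum_le_sum fun j _ => ?_
          rw [norm_mul, Real.norm_of_nonneg (h0 i j)]
          exact mul_le_mul_of_nonneg_left (norm_le_pi_norm u j) (h0 i j)
      _ ≤ ‖u‖ := by
          rw [← Finset.sum_mul]
          exact mul_le_of_le_one_left (norm_nonneg u) (h1 i)
  -- Since `M v = v - y` and `M y = y`, the vector `v - k y` is `Mᵏ v`, and `M` is a contraction in
  -- the sup norm. Boundedness in `k` forces `y = 0`.
  have hiter : ∀ k : ℕ, ‖v - (k : ℝ) • y‖ ≤ ‖v‖ := by
    intro k
    induction k with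
    | zero => simp
    | succ k ih =>
      have : v - ((k + 1 : ℕ) : ℝ) • y = M.mulVec (v - (k : ℝ) • y) := by
        rw [Matrix.mulVec_sub, Matrix.mulVec_smul, hMv, hMy]
        push_cast
        module
      rw [this]
      exact (hnorm _).trans ih
  by_contra hne
  have hpos : 0 < ‖y‖ := norm_pos_iff.mpr hne
  obtain ⟨k, hk⟩ := exists_nat_gt (2 * ‖v‖ / ‖y‖)
  rw [div_lt_iff₀ hpos] at hk
  have h2 : (k : ℝ) * ‖y‖ = ‖(k : ℝ) • y‖ := by simp [norm_smul]
  have h3 : ‖(k : ℝ) • y‖ ≤ ‖v‖ + ‖v - (k : ℝ) • y‖ := by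
    simpa using norm_sub_le v (v - (k : ℝ) • y)
  linarith [hiter k]

end GroupInverse

/-! ### The censored chain is substochastic -/

section Censored

/-- Rewrites visit-time events as countable Boolean combinations of events on single coordinates,
which are measurable. -/
theorem iInf_natCast_eq_iff {p : ℕ → Prop} {n : ℕ} :
    (⨅ (m : ℕ) (_ : p m), (m : ℕ∞)) = n ↔ p n ∧ ∀ m < n, ¬ p m := by
  constructor
  · intro h
    have hlt : ∀ m < n, ¬ p m := by
      intro m hm hp
      have : (n : ℕ∞) ≤ m := h ▸ iInf₂_le m hp
      exact absurd (Nat.cast_le.mp this) hm.not_ge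
    refine ⟨?_, hlt⟩
    by_contra hn
    have : ((n + 1 : ℕ) : ℕ∞) ≤ ⨅ (m : ℕ) (_ : p m), (m : ℕ∞) := by
      refine le_iInf₂ fun m hm => Nat.cast_le.mpr ?_
      rcases lt_trichotomy m n with h' | h' | h'
      · exact absurd hm (hlt m h')
      · exact absurd (h' ▸ hm) hn
      · exact h'
    rw [h, Nat.cast_le] at this
    omega
  · rintro ⟨hp, hlt⟩
    refine le_antisymm (iInf₂_le n hp) (le_iInf₂ fun m hm => Nat.cast_le.mpr ?_)
    by_contra! h
    exact hlt m h hm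

theorem add_one_le_natCast_iff {v : ℕ∞} {m : ℕ} :
    v + 1 ≤ (m : ℕ∞) ↔ ∃ n < m, v = (n : ℕ∞) := by
  induction v using ENat.recTopCoe with
  | top => simp
  | coe v =>
    norm_cast
    simp

variable {E Ω : Type*} [MeasurableSpace E] [DiscreteMeasurableSpace E] [MeasurableSpace Ω]
  {Φ : ℕ → Ω → E} (hΦ : ∀ n, Measurable (Φ n))
include hΦ

theorem measurableSet_visitTime_eq (A : Set E) (k n : ℕ) :
    MeasurableSet {ω | visitTime A (fun k => Φ k ω) k = (n : ℕ∞)} := by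
  have hA : ∀ m, Measurable fun ω => Φ m ω ∈ A :=
    fun m => measurableSet_setOfPred.mp (hΦ m .of_discrete)
  rw [measurableSet_setOfPred]
  induction k generalizing n with
  | zero =>
    simp only [visitTime, iInf_natCast_eq_iff]
    exact (hA n).and (.forall fun m => .forall fun _ => (hA m).not)
  | succ k ih =>
    have hm : ∀ m : ℕ, Measurable fun ω => visitTime A (fun k => Φ k ω) k + 1 ≤ (m : ℕ∞) ∧
        Φ m ω ∈ A := by
      intro m
      simp only [add_one_le_natCast_iff, ← exists_prop (a := _ < _)]
      exact (Measurable.exists fun n => .exists fun _ => ih n).and (hA m)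
    simp only [visitTime, iInf_and', iInf_natCast_eq_iff]
    exact (hm n).and (.forall fun m => .forall fun _ => (hm m).not)

theorem measurableSet_censored (A : Set E) (j : E) :
    MeasurableSet {ω | ∃ m : ℕ, visitTime A (fun k => Φ k ω) 1 = (m : ℕ∞) ∧ Φ m ω = j} := by
  rw [measurableSet_setOfPred]
  exact .exists fun m => (measurableSet_setOfPred.mp (measurableSet_visitTime_eq hΦ A 1 m)).and
    (measurableSet_setOfPred.mp (hΦ m (MeasurableSet.of_discrete (s := {j}))))

/-- The visit time takes a single value, so the events for distinct `j` are disjoint. Paths that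
never return are not counted, hence an inequality. -/
theorem sum_censoredMatrix_le {ℙ : E → Measure Ω} (hℙ : ∀ i, IsProbabilityMeasure (ℙ i))
    (A : Finset E) (i : A) : ∑ j, censoredMatrix ℙ Φ A i j ≤ 1 := by
  have hpi := hℙ i
  simp only [censoredMatrix]
  rw [← ENNReal.toReal_sum fun _ _ => measure_ne_top _ _, ← measure_biUnion_finset]
  · exact ENNReal.toReal_le_of_le_ofReal zero_le_one (by simpa using prob_le_one)
  · intro j _ j' _ hne
    refine Set.disjoint_left.mpr ?_
    rintro ω ⟨m, hm, hj⟩ ⟨m', hm', hj'⟩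
    rw [hm, Nat.cast_inj] at hm'
    subst hm'
    exact hne (Subtype.ext (hj.symm.trans hj'))
  · exact fun j _ => measurableSet_censored hΦ _ _

end Censored

/-! ### Reindexing -/

section Reindex

variable {α β : Type*} [DecidableEq α] [DecidableEq β] (M : Matrix β β ℝ) (e : α ≃ β)

theorem infPow_submatrix (k : ℕ) :
    infPow (M.submatrix e e) k = (infPow M k).submatrix e e := by
  induction k with
  | zero => exact (Matrix.submatrix_one_equiv e).symm
  | succ k ih =>
    ext i j
    rw [infPow, ih]
    exact e.tsum_eq fun l => infPow M k (e i) l * M l (e j)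

theorem hat_submatrix : hat (M.submatrix e e) = (hat M).submatrix e e := by
  ext i j
  simp only [hat, infPow_submatrix, Matrix.submatrix_apply]

variable {M} in
theorem HatConverges.submatrix (h : HatConverges M) : HatConverges (M.submatrix e e) where
  powers k i j := by
    rw [infPow_submatrix]
    exact (h.powers k (e i) (e j)).comp_injective e.injective
  series i j := by
    simp only [infPow_submatrix]
    exact h.series (e i) (e j)

end Reindex

/-! ### Matrix-valued series -/

theorem hasSum_matrix {ι m n : Type*} {f : ι → Matrix m n ℝ} {S : Matrix m n ℝ} :
    HasSum f S ↔ ∀ k l, HasSum (fun i => f i k l) (S k l) := by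
  exact Pi.hasSum.trans (forall_congr' fun k => Pi.hasSum)

/-- A summable double-indexed family may be summed first over the finite index. -/
theorem hasSum_sum_fiber {ι κ : Type*} [Fintype κ] {f : ι × κ → ℝ} (hf : Summable f) :
    HasSum (fun i => ∑ k, f (i, k)) (∑' p, f p) :=
  hf.hasSum.prod_fiberwise fun _ => hasSum_fintype _

theorem sum_tsum_fiber {ι κ : Type*} [Fintype κ] {f : ι × κ → ℝ} (hf : Summable f) :
    ∑ k, ∑' i, f (i, k) = ∑' p, f p := by
  rw [← (hasSum_sum_fiber hf).tsum_eq, Summable.tsum_finsetSum]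
  exact fun k _ => hf.comp_injective (Prod.mk_left_injective k)

/-! ### Chains of GI/G/1-type -/

section Chain

variable {d : ℕ}

theorem mem_level0 {x : ℕ × Fin d} : x ∈ level0 d ↔ x.1 = 0 := by
  rw [level0, Finset.mem_product, Finset.mem_singleton]
  exact and_iff_left (Finset.mem_univ _)

/-- Level `0` is indexed by the phases. -/
def level0Equiv (d : ℕ) : Fin d ≃ level0 d where
  toFun := level0State
  invFun x := x.1.2
  left_inv _ := rfl
  right_inv x := by
    obtain ⟨⟨i, k⟩, h⟩ := x
    have : i = 0 := mem_level0.mp h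
    subst this
    rfl

theorem notMem_level0 (n : ℕ+) (k : Fin d) : ((n : ℕ), k) ∉ level0 d :=
  fun h => n.ne_zero (mem_level0.mp h)

/-- The states off level `0` are indexed by a positive level and a phase. -/
def complEquiv (d : ℕ) : ℕ+ × Fin d ≃ {x : ℕ × Fin d // x ∉ level0 d} where
  toFun p := ⟨((p.1 : ℕ), p.2), notMem_level0 p.1 p.2⟩
  invFun x := (⟨x.1.1, Nat.pos_of_ne_zero fun h => x.2 (mem_level0.mpr h)⟩, x.1.2)
  left_inv _ := rfl
  right_inv _ := rfl

theorem complEquiv_coe (p : ℕ+ × Fin d) : (complEquiv d p : ℕ × Fin d) = ((p.1 : ℕ), p.2) := rfl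

variable {A B : ℤ → Matrix (Fin d) (Fin d) ℝ}

theorem PBB_submatrix :
    (PBB (gig1Matrix A B) (level0 d)).submatrix (complEquiv d) (complEquiv d) =
      repeatingPart A := by
  ext x y
  simp [PBB, gig1Matrix, repeatingPart, complEquiv_coe]

theorem PAB_apply (k : Fin d) (p : ℕ+ × Fin d) :
    PAB (gig1Matrix A B) (level0 d) (level0State k) (complEquiv d p) = B p.1 k p.2 := by
  simp [PAB, gig1Matrix, level0State, complEquiv_coe]

theorem PBA_apply (p : ℕ+ × Fin d) (l : Fin d) :
    PBA (gig1Matrix A B) (level0 d) (complEquiv d p) (level0State l) =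
      B (-(p.1 : ℤ)) p.2 l := by
  simp [PBA, gig1Matrix, level0State, complEquiv_coe]

theorem hat_repeatingPart (A B : ℤ → Matrix (Fin d) (Fin d) ℝ) (p q : ℕ+ × Fin d) :
    hat (repeatingPart A) p q =
      hat (PBB (gig1Matrix A B) (level0 d)) (complEquiv d p) (complEquiv d q) := by
  rw [← PBB_submatrix (B := B), hat_submatrix]
  rfl

variable (A B) in
/-- The blocks of `P_AB P̂_BB`. -/
def exitBlock (j : ℕ+) : Matrix (Fin d) (Fin d) ℝ := Matrix.of fun k l =>
  infMul (PAB (gig1Matrix A B) (level0 d)) (hat (PBB (gig1Matrix A B) (level0 d)))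
    (level0State k) (complEquiv d (j, l))

variable (A B) in
/-- The blocks of `P̂_BB P_BA`. -/
def entranceBlock (i : ℕ+) : Matrix (Fin d) (Fin d) ℝ := Matrix.of fun k l =>
  infMul (hat (PBB (gig1Matrix A B) (level0 d))) (PBA (gig1Matrix A B) (level0 d))
    (complEquiv d (i, k)) (level0State l)

variable (hs : SeriesConverge (gig1Matrix A B) (level0 d))
include hs

theorem hasSum_exitBlock (j : ℕ+) :
    HasSum (fun n : ℕ+ => B n * block (hat (repeatingPart A)) n j) (exitBlock A B j) := by
  refine hasSum_matrix.mpr fun k l => ?_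
  have h := hasSum_sum_fiber ((hs.mul_hat (level0State k) (complEquiv d (j, l))).comp_injective
    (complEquiv d).injective)
  convert h using 1
  · funext n
    simp only [Matrix.mul_apply, block, Matrix.of_apply, Function.comp_apply, PAB_apply,
      hat_repeatingPart A B]
  · exact ((complEquiv d).tsum_eq fun p => PAB (gig1Matrix A B) (level0 d) (level0State k) p *
      hat (PBB (gig1Matrix A B) (level0 d)) p (complEquiv d (j, l))).symm

theorem hasSum_entranceBlock (i : ℕ+) :
    HasSum (fun m : ℕ+ => block (hat (repeatingPart A)) i m * B (-(m : ℤ)))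
      (entranceBlock A B i) := by
  refine hasSum_matrix.mpr fun k l => ?_
  have h := hasSum_sum_fiber ((hs.hat_mul (complEquiv d (i, k)) (level0State l)).comp_injective
    (complEquiv d).injective)
  convert h using 1
  · funext n
    simp only [Matrix.mul_apply, block, Matrix.of_apply, Function.comp_apply, PBA_apply,
      hat_repeatingPart A B]
  · exact ((complEquiv d).tsum_eq fun p =>
      hat (PBB (gig1Matrix A B) (level0 d)) (complEquiv d (i, k)) p *
        PBA (gig1Matrix A B) (level0 d) p (level0State l)).symm

theorem summable_exitBlock : Summable (exitBlock A B) :=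
  ⟨_, hasSum_matrix.mpr fun k l => (((hs.rowSum_mul_hat (level0State k)).comp_injective
    (complEquiv d).injective).comp_injective (Prod.mk_left_injective l)).hasSum⟩

theorem summable_hatBlock (i : ℕ+) :
    Summable fun m : ℕ+ => block (hat (repeatingPart A)) i m := by
  refine ⟨Matrix.of fun k l => ∑' m, hat (repeatingPart A) (i, k) (m, l),
    hasSum_matrix.mpr fun k l => Summable.hasSum ?_⟩
  simp only [block, Matrix.of_apply, hat_repeatingPart A B]
  exact ((hs.rowSum_hat (complEquiv d (i, k))).comp_injective
    (complEquiv d).injective).comp_injective (Prod.mk_left_injective l)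

theorem tsum_exitBlock_mulVec_one (k : Fin d) :
    (∑' m, exitBlock A B m).mulVec 1 k =
      rowSum (infMul (PAB (gig1Matrix A B) (level0 d))
        (hat (PBB (gig1Matrix A B) (level0 d)))) (level0State k) := by
  have h := hasSum_matrix.mp (summable_exitBlock hs).hasSum k
  simp only [Matrix.mulVec, dotProduct, Pi.one_apply, mul_one, ← (h _).tsum_eq]
  rw [rowSum, ← (complEquiv d).tsum_eq]
  exact sum_tsum_fiber ((hs.rowSum_mul_hat (level0State k)).comp_injective
    (complEquiv d).injective)

theorem tsum_hatBlock_mulVec_one (i : ℕ+) (k : Fin d) :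
    (∑' m : ℕ+, block (hat (repeatingPart A)) i m).mulVec 1 k =
      rowSum (hat (PBB (gig1Matrix A B) (level0 d))) (complEquiv d (i, k)) := by
  have h := hasSum_matrix.mp (summable_hatBlock hs i).hasSum k
  simp only [Matrix.mulVec, dotProduct, Pi.one_apply, mul_one, ← (h _).tsum_eq]
  rw [rowSum, ← (complEquiv d).tsum_eq]
  simp only [block, Matrix.of_apply, hat_repeatingPart A B]
  exact sum_tsum_fiber ((hs.rowSum_hat (complEquiv d (i, k))).comp_injective
    (complEquiv d).injective)

variable (π : ℕ × Fin d → ℝ) (PA : Matrix (level0 d) (level0 d) ℝ)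

theorem solutionA_zero (k l : Fin d) :
    solutionA (gig1Matrix A B) π (level0 d) PA (level0State k) (0, l) =
      ((groupInverse (1 - PA)).submatrix (level0Equiv d) (level0Equiv d) *
        (1 - (1 + ∑' m, exitBlock A B m) * ePi π 0) : Matrix _ _ ℝ) k l := by
  rw [solutionA, Matrix.mul_apply, Matrix.mul_apply, ← (level0Equiv d).sum_comp]
  refine Finset.sum_congr rfl fun q _ => congrArg₂ _ rfl ?_
  rw [ePi, Matrix.mul_vecMulVec, Matrix.add_mulVec, Matrix.one_mulVec]
  simp only [Matrix.sub_apply, Matrix.of_apply, Matrix.vecMulVec_apply, Pi.add_apply,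
    tsum_exitBlock_mulVec_one hs]
  have h0 : ((0 : ℕ), l) ∈ level0 d := (level0State l).2
  rw [dif_pos h0]
  congr 1
  exact congrFun (congrFun (Matrix.submatrix_one_equiv (α := ℝ) (level0Equiv d)) q) l

theorem solutionA_pos (j : ℕ+) (k l : Fin d) :
    solutionA (gig1Matrix A B) π (level0 d) PA (level0State k) ((j : ℕ), l) =
      ((groupInverse (1 - PA)).submatrix (level0Equiv d) (level0Equiv d) *
        (exitBlock A B j - (1 + ∑' m, exitBlock A B m) * ePi π j) : Matrix _ _ ℝ) k l := by
  rw [solutionA, Matrix.mul_apply, Matrix.mul_apply, ← (level0Equiv d).sum_comp]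
  refine Finset.sum_congr rfl fun q _ => congrArg₂ _ rfl ?_
  rw [ePi, Matrix.mul_vecMulVec, Matrix.add_mulVec, Matrix.one_mulVec]
  simp only [Matrix.sub_apply, Matrix.of_apply, Matrix.vecMulVec_apply, Pi.add_apply,
    tsum_exitBlock_mulVec_one hs]
  rw [dif_neg (notMem_level0 j l)]
  rfl

omit hs in
theorem block_solution_zero (j : ℕ) (k l : Fin d) :
    block (solution (gig1Matrix A B) π (level0 d) PA) 0 j k l =
      solutionA (gig1Matrix A B) π (level0 d) PA (level0State k) (j, l) :=
  dif_pos (level0State k).2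

/-- The case split on the column is kept so that one statement serves both `j = 0` and `j ≥ 1`. -/
theorem block_solution_pos (i : ℕ+) (j : ℕ) (k l : Fin d) :
    block (solution (gig1Matrix A B) π (level0 d) PA) i j k l =
      (entranceBlock A B i * block (solution (gig1Matrix A B) π (level0 d) PA) 0 j) k l +
      (if h : (j, l) ∈ level0 d then 0 else
        hat (PBB (gig1Matrix A B) (level0 d)) (complEquiv d (i, k)) ⟨(j, l), h⟩) -
      ((∑' m : ℕ+, block (hat (repeatingPart A)) i m) * ePi π j) k l := by
  rw [ePi, Matrix.mul_vecMulVec, Matrix.vecMulVec_apply, tsum_hatBlock_mulVec_one hs,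
    Matrix.mul_apply]
  simp only [block_solution_zero]
  refine (dif_neg (notMem_level0 i k)).trans ?_
  rw [solutionB, Matrix.sub_apply, Matrix.add_apply, Matrix.mul_apply,
    ← (level0Equiv d).sum_comp]
  rfl

end Chain

end GIG1

end

open GIG1 in
theorem theorem3 {d : ℕ} (A B : ℤ → Matrix (Fin d) (Fin d) ℝ)
    (hP : IsStochastic (gig1Matrix A B))
    {Ω : Type*} [MeasurableSpace Ω] (ℙ : ℕ × Fin d → Measure Ω) (Φ : ℕ → Ω → ℕ × Fin d)
    (hΦ : IsMarkovChain (gig1Matrix A B) ℙ Φ)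
    (hirr : (gig1Matrix A B).IsIrreducible)
    (hrec : IsPositiveRecurrent ℙ Φ)
    (π : ℕ × Fin d → ℝ) (hπ : IsInvariantProbability (gig1Matrix A B) π) :
    let PA := censoredMatrix ℙ Φ (level0 d)
    let X := block (solution (gig1Matrix A B) π (level0 d) PA)
    let P0 : Matrix (Fin d) (Fin d) ℝ := PA.submatrix level0State level0State
    let H := block (hat (repeatingPart A))
    -- all the objects in the formulas exist: group inverses and convergent series
    IsGroupInverse (1 - PA) (groupInverse (1 - PA)) ∧
    IsGroupInverse (1 - P0) (groupInverse (1 - P0)) ∧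
    SeriesConverge (gig1Matrix A B) (level0 d) ∧
    HatConverges (repeatingPart A) ∧
    (∀ j : ℕ+, Summable fun n : ℕ+ => B n * H n j) ∧
    (Summable fun m : ℕ+ => ∑' n : ℕ+, B n * H n m) ∧
    (∀ i : ℕ+, Summable fun m : ℕ+ => H i m * B (-(m : ℤ))) ∧
    (∀ i : ℕ+, Summable fun m : ℕ+ => H i m) ∧
    -- the formulas for the blocks
    X 0 0 = groupInverse (1 - P0) *
      (1 - (1 + ∑' m : ℕ+, ∑' n : ℕ+, B n * H n m) * ePi π 0) ∧
    (∀ j : ℕ+, X 0 j = X 0 0 * ∑' n : ℕ+, B n * H n j) ∧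
    (∀ i : ℕ+, X i 0 =
      (∑' m : ℕ+, H i m * B (-(m : ℤ))) * X 0 0 - (∑' m : ℕ+, H i m) * ePi π 0) ∧
    (∀ i j : ℕ+, X i j =
      (∑' m : ℕ+, H i m * B (-(m : ℤ))) * X 0 j + H i j - (∑' m : ℕ+, H i m) * ePi π j) := by
  intro PA X P0 H
  -- For `d = 0` the state space is empty and `π` could not have mass 1.
  have hd : Nonempty (Fin d) := by
    by_contra h
    rw [not_nonempty_iff] at h
    exact zero_ne_one (hasSum_empty.unique hπ.hasSum_one)
  have hA : (level0 d).Nonempty := ⟨_, (level0State hd.some).2⟩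
  have hs := seriesConverge (level0 d) hP hirr hπ hA
  have hPA : IsGroupInverse (1 - PA) (groupInverse (1 - PA)) :=
    isGroupInverse_groupInverse (exists_isGroupInverse_one_sub (fun _ _ => ENNReal.toReal_nonneg)
      (sum_censoredMatrix_le hΦ.measurable hΦ.isProbabilityMeasure _))
  -- `P0` is `PA` with level 0 numbered by phases; uniqueness then identifies the two group inverses
  -- up to this relabelling.
  have hP0 : IsGroupInverse (1 - P0)
      ((groupInverse (1 - PA)).submatrix (level0Equiv d) (level0Equiv d)) := by
    have h := hPA.submatrix (level0Equiv d)
    rwa [Matrix.submatrix_sub, Pi.sub_apply, Pi.sub_apply, Matrix.submatrix_one_equiv] at h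
  have hP0' := isGroupInverse_groupInverse ⟨_, hP0⟩
  have hG : groupInverse (1 - P0) =
      (groupInverse (1 - PA)).submatrix (level0Equiv d) (level0Equiv d) := hP0'.unique hP0
  have hexit : ∀ j : ℕ+, ∑' n : ℕ+, B n * H n j = exitBlock A B j :=
    fun j => (hasSum_exitBlock hs j).tsum_eq
  have hentr : ∀ i : ℕ+, ∑' m : ℕ+, H i m * B (-(m : ℤ)) = entranceBlock A B i :=
    fun i => (hasSum_entranceBlock hs i).tsum_eq
  have hX00 : X 0 0 = groupInverse (1 - P0) * (1 - (1 + ∑' m, exitBlock A B m) * ePi π 0) := by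
    ext k l
    rw [hG]
    exact (block_solution_zero π PA 0 k l).trans (solutionA_zero hs π PA k l)
  -- The block form of `π_B = π_A P_AB P̂_BB`, with the same row repeated by `e`.
  have hpi : ∀ j : ℕ+, ePi π 0 * exitBlock A B j = ePi π j := by
    intro j
    ext k l
    have h := invariant_compl_eq (level0 d) hP hirr hπ hA (complEquiv d (j, l))
    rw [← (level0Equiv d).sum_comp] at h
    simp only [ePi, Matrix.mul_apply, Matrix.vecMulVec_apply, Pi.one_apply, one_mul]
    exact h.symm
  refine ⟨hPA, hP0', hs, PBB_submatrix (A := A) (B := B) ▸ hs.hat.submatrix (complEquiv d),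
    fun j => (hasSum_exitBlock hs j).summable, ?_, fun i => (hasSum_entranceBlock hs i).summable,
    summable_hatBlock hs, ?_, ?_, ?_, ?_⟩
  · simp only [hexit]
    exact summable_exitBlock hs
  · simp only [hexit]
    exact hX00
  · intro j
    rw [hexit, hX00, Matrix.mul_assoc, Matrix.sub_mul, Matrix.one_mul, Matrix.mul_assoc, hpi, hG]
    ext k l
    exact (block_solution_zero π PA j k l).trans (solutionA_pos hs π PA j k l)
  · intro i
    rw [hentr]
    ext k l
    refine (block_solution_pos hs π PA i 0 k l).trans ?_
    rw [dif_pos (mem_level0.mpr rfl), add_zero]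
    rfl
  · intro i j
    rw [hentr]
    ext k l
    refine (block_solution_pos hs π PA i j k l).trans ?_
    rw [dif_neg (notMem_level0 j l), Matrix.sub_apply, Matrix.add_apply]
    congr 2
    exact (hat_repeatingPart A B (i, k) (j, l)).symm
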